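/- Let $d\ge 0$, $N\ge 1$, let $\mathcal H$ be a real Hilbert space and let $\varphi:\mathbb R^d\to\mathcal H$ be smooth ($C^\infty$); for $p\in\mathcal H$ write $(\Phi^*p)(x)=\langle \varphi(x),p\rangle$. For a polynomial $P=\sum_\alpha a_\alpha X^\alpha$ put $P(\partial)=\sum_\alpha a_\alpha\partial^\alpha$. Let $Z=(z_i)_{i=1}^N\in(\mathbb R^d)^N$. *Least interpolant space.* Consider the $(d+1)N$ functionals $F_{i,0}(P)=P(z_i)$, $F_{i,k}(P)=(\partial_kP)(z_i)$ ($1\le i\le N$, $1\le k\le d$) on real polynomials in $d$ variables. For each such functional let $g_F(x)=\sum_\alpha \frac{F(X^\alpha)}{\alpha!}x^\alpha$. The least term $g_\downarrow$ of a nonzero power series $g$ is its nonzero homogeneous part of lowest degree (and $0_\downarrow=0$). Let $\mathcal S_Z=\operatorname{span}\{g_\downarrow : g\in\operatorname{span}\{g_{F_{i,k}}\}_{i,k}\}$ (the de Boor–Ron least interpolant space). *Pre-certificates.* Let $p_{V,Z}$ be the element $p\in\mathcal H$ of minimal norm subject to $(\Phi^*p)(z_i)=1$ and $\nabla(\Phi^*p)(z_i)=0$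 for all $i$. Let $p_{W,Z}$ be the element $p\in\mathcal H$ of minimal norm subject to $(\Phi^*p)(0)=1$ and $(P(\partial)[\Phi^*p])(0)=0$ for all $P\in\mathcal S_Z$ with $P(0)=0$. Put $\eta_{V,Z}=\Phi^*p_{V,Z}$ and $\eta_{W,Z}=\Phi^*p_{W,Z}$, and write $tZ=(tz_i)_{i=1}^N$. **Theorem.** Assume that $\{h(\partial)\varphi(0): h\in\mathcal S_Z\}$ has dimension $(d+1)N$ (that is, $3N$ when $d=2$). Then $p_{W,Z}$ exists and is unique, $p_{V,tZ}$ exists and is unique for all sufficiently small $t>0$, and, as $t\to0^+$, $$\|p_{V,tZ}-p_{W,Z}\|_{\mathcal H}=O(t).$$ If moreover $\sup_{x}\|\varphi(x)\|<\infty$, then also $$\sup_{x\in\mathbb R^d}|\eta_{V,tZ}(x)-\eta_{W,Z}(x)|=O(t).$$ -/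

import Mathlib

open Filter Topology Asymptotics
open scoped ContDiff

noncomputable section

namespace Superres

/-! ### Least interpolant spaces -/

/-- The formal power series `g_F(x) = F(exp⟨·, x⟩) = ∑_α F(X^α) / α! x^α` of a linear functional `F`
on polynomials in `d` variables. -/
def expSeries {d : ℕ} (F : MvPolynomial (Fin d) ℝ →ₗ[ℝ] ℝ) : MvPowerSeries (Fin d) ℝ :=
  fun α => F (MvPolynomial.monomial α 1) / ∏ k, ((α k).factorial : ℝ)

/-- The space `exp_F` spanned by the series `g_F` of a family of functionals. -/
def expSpace {d : ℕ} {ι : Type*} (F : ι → (MvPolynomial (Fin d) ℝ →ₗ[ℝ] ℝ)) :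
    Submodule ℝ (MvPowerSeries (Fin d) ℝ) :=
  Submodule.span ℝ (Set.range fun i => expSeries (F i))

/-- The least term of a power series: its nonzero homogeneous part of lowest total degree
(and `0` for the zero series). -/
def leastTerm {d : ℕ} (g : MvPowerSeries (Fin d) ℝ) : MvPolynomial (Fin d) ℝ :=
  ∑ α ∈ Finset.finsuppAntidiag Finset.univ (MvPowerSeries.order g).toNat,
    MvPolynomial.monomial α (MvPowerSeries.coeff α g)

/-- The least interpolant space of a family of functionals: the span of the least terms of all the
elements of `exp_F`. -/
def leastInterpolant {d : ℕ} {ι : Type*} (F : ι → (MvPolynomial (Fin d) ℝ →ₗ[ℝ] ℝ)) :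
    Submodule ℝ (MvPolynomial (Fin d) ℝ) :=
  Submodule.span ℝ (leastTerm '' (expSpace F : Set (MvPowerSeries (Fin d) ℝ)))

/-- The first-order Hermite functionals at `Z`: the value `P ↦ P(z_i)` (index `(i, none)`) and the
first partial derivatives `P ↦ (∂_k P)(z_i)` (index `(i, some k)`). -/
def hermiteFunctional {d N : ℕ} (Z : Fin N → EuclideanSpace ℝ (Fin d)) :
    Fin N × Option (Fin d) → (MvPolynomial (Fin d) ℝ →ₗ[ℝ] ℝ)
  | (i, none) => (MvPolynomial.aeval fun j => Z i j).toLinearMap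
  | (i, some k) =>
      (MvPolynomial.aeval fun j => Z i j).toLinearMap ∘ₗ (MvPolynomial.pderiv k).toLinearMap

/-- The least interpolant space `S_Z` of first-order Hermite interpolation at `Z`. -/
def hermiteLeastSpace {d N : ℕ} (Z : Fin N → EuclideanSpace ℝ (Fin d)) :
    Submodule ℝ (MvPolynomial (Fin d) ℝ) :=
  leastInterpolant (hermiteFunctional Z)

/-! ### Constant-coefficient differential operators -/

section Derivatives

variable {d : ℕ} {F : Type*} [NormedAddCommGroup F] [NormedSpace ℝ F]

/-- The partial derivative `∂_k f`. -/
def partialDeriv (k : Fin d) (f : EuclideanSpace ℝ (Fin d) → F) : EuclideanSpace ℝ (Fin d) → F :=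
  fun x => fderiv ℝ f x (EuclideanSpace.single k 1)

/-- The iterated partial derivative `∂^α f = ∂_1^{α_1} ⋯ ∂_d^{α_d} f`. -/
def multiDeriv (α : Fin d →₀ ℕ) (f : EuclideanSpace ℝ (Fin d) → F) :
    EuclideanSpace ℝ (Fin d) → F :=
  (List.finRange d).foldr (fun k g => (partialDeriv k)^[α k] g) f

/-- `P(∂) f = ∑_α a_α ∂^α f` for a polynomial `P = ∑_α a_α X^α`. -/
def polyDeriv (P : MvPolynomial (Fin d) ℝ) (f : EuclideanSpace ℝ (Fin d) → F) :
    EuclideanSpace ℝ (Fin d) → F :=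
  fun x => ∑ α ∈ P.support, MvPolynomial.coeff α P • multiDeriv α f x

end Derivatives

/-! ### Pre-certificates -/

section Certificates

variable {d N : ℕ} {H : Type*} [NormedAddCommGroup H] [InnerProductSpace ℝ H]

/-- `p` is the element of minimal norm of `S`: it belongs to `S`, and every other element of `S` has
strictly larger norm. -/
def IsMinNorm (S : Set H) (p : H) : Prop :=
  p ∈ S ∧ ∀ q ∈ S, q ≠ p → ‖p‖ < ‖q‖

/-- The element of minimal norm of `S` (a meaningless value if there is none). -/
def minNorm (S : Set H) : H :=
  Classical.epsilon fun p => IsMinNorm S p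

/-- The function `Φ^* p : x ↦ ⟨φ(x), p⟩`, for the adjoint `Φ^*` of the measurement operator
`Φ m = ∫ φ dm` with kernel `φ`. -/
def adjointMap (φ : EuclideanSpace ℝ (Fin d) → H) (p : H) : EuclideanSpace ℝ (Fin d) → ℝ :=
  fun x => inner ℝ (φ x) p

/-- The constraints defining the vanishing pre-certificate at `Z`:
`(Φ^* p)(z_i) = 1` and `∇(Φ^* p)(z_i) = 0` for all `i`. -/
def feasibleV (φ : EuclideanSpace ℝ (Fin d) → H) (Z : Fin N → EuclideanSpace ℝ (Fin d)) : Set H :=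
  {p | ∀ i, adjointMap φ p (Z i) = 1 ∧ gradient (adjointMap φ p) (Z i) = 0}

/-- The constraints defining the limiting pre-certificate for `Z`: `(Φ^* p)(0) = 1`, and
`P(∂)[Φ^* p](0) = 0` for all `P ∈ S_Z` with `P(0) = 0`. -/
def feasibleW (φ : EuclideanSpace ℝ (Fin d) → H) (Z : Fin N → EuclideanSpace ℝ (Fin d)) : Set H :=
  {p | adjointMap φ p 0 = 1 ∧ ∀ P ∈ hermiteLeastSpace Z, MvPolynomial.eval 0 P = 0 →
    polyDeriv P (adjointMap φ p) 0 = 0}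

/-- `p_{V,Z}`. -/
def pV (φ : EuclideanSpace ℝ (Fin d) → H) (Z : Fin N → EuclideanSpace ℝ (Fin d)) : H :=
  minNorm (feasibleV φ Z)

/-- `p_{W,Z}`. -/
def pW (φ : EuclideanSpace ℝ (Fin d) → H) (Z : Fin N → EuclideanSpace ℝ (Fin d)) : H :=
  minNorm (feasibleW φ Z)

/-- The vanishing pre-certificate `η_{V,Z} = Φ^* p_{V,Z}`. -/
def etaV (φ : EuclideanSpace ℝ (Fin d) → H) (Z : Fin N → EuclideanSpace ℝ (Fin d)) :
    EuclideanSpace ℝ (Fin d) → ℝ :=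
  adjointMap φ (pV φ Z)

/-- The limiting pre-certificate `η_{W,Z} = Φ^* p_{W,Z}`. -/
def etaW (φ : EuclideanSpace ℝ (Fin d) → H) (Z : Fin N → EuclideanSpace ℝ (Fin d)) :
    EuclideanSpace ℝ (Fin d) → ℝ :=
  adjointMap φ (pW φ Z)

end Certificates

end Superres

end

/-!
Write `w_a(t)` for the first-order Hermite functionals of `Z` applied to `x ↦ φ(t x)`, namely
`φ(t z_i)` and `t ∂_k φ(t z_i)`. For `t ≠ 0`, the constraints defining `p_{V,tZ}` read
`⟪w_a(t), p⟫ = F_a(1)`.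

Let `g = ∑_a c_a g_{F_a}` have order `n`. The homogeneous parts of `g_{F_a}` are the symbols of the
Taylor coefficients of `w_a` at `t = 0` (`dilatedHermite_sub_isBigO`), so that
`t⁻ⁿ ∑_a c_a w_a(t) = g_↓(∂)φ(0) + O(t)` (`sum_dilatedHermite_sub_leastTerm_isBigO`), while the
right-hand side `t⁻ⁿ ∑_a c_a F_a(1)` of the rescaled constraint equals `g_↓(0)` whatever `t` is
(`inv_pow_order_mul_sum_hermiteFunctional_one`).

By the dimension hypothesis there are `(d + 1) N` combinations whose limits `g_↓(∂)φ(0)` are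
linearly independent (`exists_linearIndependent_leastTerm`). The Gram determinant of the rescaled vectors is
then nonzero for small `t`, which forces the change of functionals to be invertible, so the rescaled
constraints are equivalent to the original ones (`setOf_inner_eq_of_gram_det_ne_zero`). The
minimal-norm solution is a differentiable function of the constraint vectors as long as their Gram
determinant does not vanish (`gramSolution`, `differentiableAt_gramSolution`), so `p_{V,tZ}`
converges at rate `O(t)` to the minimal-norm solution `p₀` of the limiting equations.

It remains to identify `p₀` with `p_{W,Z}`. As `1 ∈ S_Z`, the constraints of `p_{W,Z}` are
`⟪P(∂)φ(0), p⟫ = P(0)` for all `P ∈ S_Z` (`mem_feasibleW_iff`), and they include those defining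
`p₀`. Conversely `p₀` satisfies all of them: `⟪t⁻ⁿ ∑_a c_a w_a(t), p_{V,tZ}⟫ = g_↓(0)` holds for
every `g` and small `t > 0`, and passes to the limit. In particular the dimension of `S_Z` itself is
not needed.
-/

namespace Superres

/-! ### Constant-coefficient operators acting on smooth functions -/

theorem eq_sum_smul_single {d : ℕ} (z : EuclideanSpace ℝ (Fin d)) :
    z = ∑ k, z k • EuclideanSpace.single k (1 : ℝ) := by
  ext j
  simp [Finset.sum_apply, Pi.single_apply]

section Operators

variable {d : ℕ} {F : Type*} [NormedAddCommGroup F] [NormedSpace ℝ F]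
  {f : EuclideanSpace ℝ (Fin d) → F}

theorem contDiff_partialDeriv (k : Fin d) (hf : ContDiff ℝ ∞ f) :
    ContDiff ℝ ∞ (partialDeriv k f) :=
  (hf.fderiv_right (m := ∞) (by simp)).clm_apply contDiff_const

theorem contDiff_iterate_partialDeriv (k : Fin d) (n : ℕ) (hf : ContDiff ℝ ∞ f) :
    ContDiff ℝ ∞ ((partialDeriv k)^[n] f) := by
  induction n with
  | zero => exact hf
  | succ n ih =>
    rw [Function.iterate_succ_apply']
    exact contDiff_partialDeriv k ih

theorem contDiff_foldr_partialDeriv (α : Fin d → ℕ) (l : List (Fin d)) (hf : ContDiff ℝ ∞ f) :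
    ContDiff ℝ ∞ (l.foldr (fun k g => (partialDeriv k)^[α k] g) f) := by
  induction l with
  | nil => exact hf
  | cons a l ih => exact contDiff_iterate_partialDeriv a _ ih

theorem contDiff_multiDeriv (α : Fin d →₀ ℕ) (hf : ContDiff ℝ ∞ f) :
    ContDiff ℝ ∞ (multiDeriv α f) :=
  contDiff_foldr_partialDeriv α _ hf

theorem partialDeriv_comm (k l : Fin d) (hf : ContDiff ℝ ∞ f) :
    partialDeriv k (partialDeriv l f) = partialDeriv l (partialDeriv k f) := by
  have hd : Differentiable ℝ (fderiv ℝ f) :=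
    (hf.fderiv_right (m := ∞) (by simp)).differentiable (by simp)
  funext x
  have key : ∀ a b : EuclideanSpace ℝ (Fin d),
      fderiv ℝ (fun y => fderiv ℝ f y a) x b = fderiv ℝ (fderiv ℝ f) x b a := by
    intro a b
    rw [fderiv_clm_apply (hd x) (by fun_prop)]
    simp
  have hs : IsSymmSndFDerivAt ℝ f x :=
    hf.contDiffAt.isSymmSndFDerivAt (by
      simp only [minSmoothness_of_isRCLikeNormedField]
      exact WithTop.coe_le_coe.mpr le_top)
  exact (key _ _).trans ((hs.eq _ _).trans (key _ _).symm)

theorem partialDeriv_iterate_comm (k l : Fin d) (n : ℕ) (hf : ContDiff ℝ ∞ f) :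
    partialDeriv k ((partialDeriv l)^[n] f) = (partialDeriv l)^[n] (partialDeriv k f) := by
  induction n with
  | zero => rfl
  | succ n ih =>
    rw [Function.iterate_succ_apply', Function.iterate_succ_apply', ← ih,
      partialDeriv_comm k l (contDiff_iterate_partialDeriv l n hf)]

/-- Raising one exponent of an iterated partial derivative, taken over any list of distinct
indices, amounts to one further `∂_k` in front, since `∂_k` commutes past the other factors. -/
theorem partialDeriv_foldr (k : Fin d) (α : Fin d → ℕ) (l : List (Fin d)) (hl : l.Nodup)
    (hf : ContDiff ℝ ∞ f) :
    l.foldr (fun j g => (partialDeriv j)^[(α + Pi.single k 1 : Fin d → ℕ) j] g) f =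
      if k ∈ l then partialDeriv k (l.foldr (fun j g => (partialDeriv j)^[α j] g) f)
      else l.foldr (fun j g => (partialDeriv j)^[α j] g) f := by
  induction l with
  | nil => simp
  | cons a l ih =>
    rw [List.nodup_cons] at hl
    rw [List.foldr_cons, ih hl.2, List.foldr_cons]
    by_cases hk : k = a
    · subst hk
      simp [hl.1, Function.iterate_succ_apply']
    · by_cases hkl : k ∈ l
      · simp only [Pi.add_apply, Pi.single_apply, Ne.symm hk, if_false, add_zero, hkl, if_true,
          List.mem_cons, or_true]
        rw [partialDeriv_iterate_comm k a _ (contDiff_foldr_partialDeriv α l hf)]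
      · simp [hk, Ne.symm hk, hkl]

theorem partialDeriv_multiDeriv (k : Fin d) (α : Fin d →₀ ℕ) (hf : ContDiff ℝ ∞ f) :
    partialDeriv k (multiDeriv α f) = multiDeriv (α + Finsupp.single k 1) f := by
  have h := partialDeriv_foldr (f := f) k α (List.finRange d) (List.nodup_finRange d) hf
  rw [if_pos (List.mem_finRange k)] at h
  simp only [multiDeriv]
  rw [← h]
  congr 1
  funext j g
  simp [Finsupp.single_eq_pi_single]

theorem multiDeriv_zero : multiDeriv 0 f = f := by
  have : ∀ l : List (Fin d),
      l.foldr (fun k g => (partialDeriv k)^[(0 : Fin d →₀ ℕ) k] g) f = f := by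
    intro l
    induction l with
    | nil => rfl
    | cons a l ih => rw [List.foldr_cons, ih]; rfl
  exact this _

theorem partialDeriv_clm_comp {G : Type*} [NormedAddCommGroup G] [NormedSpace ℝ G]
    (L : F →L[ℝ] G) (k : Fin d) (hf : ContDiff ℝ ∞ f) :
    partialDeriv k (fun x => L (f x)) = fun x => L (partialDeriv k f x) := by
  funext x
  have := (L.hasFDerivAt.comp x (hf.differentiable (by simp) x).hasFDerivAt).fderiv
  simp only [partialDeriv]
  change fderiv ℝ (L ∘ f) x _ = _
  rw [this]
  rfl

theorem multiDeriv_clm_comp {G : Type*} [NormedAddCommGroup G] [NormedSpace ℝ G]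
    (L : F →L[ℝ] G) (α : Fin d →₀ ℕ) (hf : ContDiff ℝ ∞ f) :
    multiDeriv α (fun x => L (f x)) = fun x => L (multiDeriv α f x) := by
  have hit : ∀ (k : Fin d) (n : ℕ) (g : EuclideanSpace ℝ (Fin d) → F), ContDiff ℝ ∞ g →
      (partialDeriv k)^[n] (fun x => L (g x)) = fun x => L ((partialDeriv k)^[n] g x) := by
    intro k n g hg
    induction n with
    | zero => rfl
    | succ n ih =>
      rw [Function.iterate_succ_apply', Function.iterate_succ_apply', ih,
        partialDeriv_clm_comp L k (contDiff_iterate_partialDeriv k n hg)]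
  have : ∀ l : List (Fin d), l.foldr (fun k g => (partialDeriv k)^[α k] g) (fun x => L (f x)) =
      fun x => L (l.foldr (fun k g => (partialDeriv k)^[α k] g) f x) := by
    intro l
    induction l with
    | nil => rfl
    | cons a l ih =>
      rw [List.foldr_cons, ih, List.foldr_cons, hit _ _ _ (contDiff_foldr_partialDeriv α l hf)]
  exact this _

theorem polyDeriv_eq_sum_of_support_subset (P : MvPolynomial (Fin d) ℝ)
    {s : Finset (Fin d →₀ ℕ)} (hs : P.support ⊆ s) (x : EuclideanSpace ℝ (Fin d)) :
    polyDeriv P f x = ∑ α ∈ s, MvPolynomial.coeff α P • multiDeriv α f x := by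
  refine Finset.sum_subset hs fun α _ hα => ?_
  rw [MvPolynomial.notMem_support_iff.mp hα, zero_smul]

/-- The map `P ↦ (P(∂) f)(x)`, sending a symbol to the value of its operator, as a linear map. -/
noncomputable def polyDerivLinear (f : EuclideanSpace ℝ (Fin d) → F)
    (x : EuclideanSpace ℝ (Fin d)) :
    MvPolynomial (Fin d) ℝ →ₗ[ℝ] F where
  toFun P := polyDeriv P f x
  map_add' P Q := by
    classical
    rw [polyDeriv_eq_sum_of_support_subset (P + Q) MvPolynomial.support_add,
      polyDeriv_eq_sum_of_support_subset P Finset.subset_union_left,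
      polyDeriv_eq_sum_of_support_subset Q Finset.subset_union_right, ← Finset.sum_add_distrib]
    simp [add_smul]
  map_smul' c P := by
    rw [polyDeriv_eq_sum_of_support_subset (c • P) MvPolynomial.support_smul]
    simp [polyDeriv, Finset.smul_sum, mul_smul]

theorem polyDerivLinear_apply (P : MvPolynomial (Fin d) ℝ) (x : EuclideanSpace ℝ (Fin d)) :
    polyDerivLinear f x P = polyDeriv P f x := rfl

theorem polyDerivLinear_monomial (α : Fin d →₀ ℕ) (a : ℝ) (x : EuclideanSpace ℝ (Fin d)) :
    polyDerivLinear f x (MvPolynomial.monomial α a) = a • multiDeriv α f x := by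
  classical
  rw [polyDerivLinear_apply,
    polyDeriv_eq_sum_of_support_subset _ MvPolynomial.support_monomial_subset]
  simp

theorem polyDerivLinear_one (x : EuclideanSpace ℝ (Fin d)) : polyDerivLinear f x 1 = f x := by
  have := polyDerivLinear_monomial (f := f) 0 1 x
  rwa [multiDeriv_zero, one_smul] at this

theorem contDiff_polyDerivLinear (hf : ContDiff ℝ ∞ f) (P : MvPolynomial (Fin d) ℝ) :
    ContDiff ℝ ∞ fun x => polyDerivLinear f x P := by
  simp only [polyDerivLinear_apply, polyDeriv]
  exact ContDiff.sum fun α _ => contDiff_const.smul (contDiff_multiDeriv α hf)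

/-- On smooth functions, composing with `∂_k` multiplies the symbol by `X_k`. -/
theorem partialDeriv_polyDerivLinear (hf : ContDiff ℝ ∞ f) (k : Fin d)
    (P : MvPolynomial (Fin d) ℝ) (x : EuclideanSpace ℝ (Fin d)) :
    partialDeriv k (fun y => polyDerivLinear f y P) x =
      polyDerivLinear f x (MvPolynomial.X k * P) := by
  have hdiff : ∀ Q, DifferentiableAt ℝ (fun y => polyDerivLinear f y Q) x := fun Q =>
    (contDiff_polyDerivLinear hf Q).differentiable (by simp) x
  induction P using MvPolynomial.induction_on' with
  | monomial α a =>
    have h1 : MvPolynomial.X k * MvPolynomial.monomial α a =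
        MvPolynomial.monomial (α + Finsupp.single k 1) a := by
      rw [MvPolynomial.X, MvPolynomial.monomial_mul, one_mul, add_comm]
    rw [h1, polyDerivLinear_monomial, ← partialDeriv_multiDeriv k α hf]
    simp only [polyDerivLinear_monomial, partialDeriv]
    rw [fderiv_fun_const_smul ((contDiff_multiDeriv α hf).differentiable (by simp) x)]
    rfl
  | add P Q hP hQ =>
    rw [mul_add, map_add, ← hP, ← hQ]
    simp only [partialDeriv, map_add]
    rw [fderiv_fun_add (hdiff P) (hdiff Q)]
    rfl

/-- The linear form `⟨z, X⟩`, the symbol of the directional derivative along `z`. -/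
noncomputable def linForm (z : EuclideanSpace ℝ (Fin d)) : MvPolynomial (Fin d) ℝ :=
  ∑ k, z k • MvPolynomial.X k

/-- Differentiating along the ray through `z` multiplies the symbol by `⟨z, X⟩`. -/
theorem hasDerivAt_polyDerivLinear_smul (hf : ContDiff ℝ ∞ f) (P : MvPolynomial (Fin d) ℝ)
    (z : EuclideanSpace ℝ (Fin d)) (t : ℝ) :
    HasDerivAt (fun s : ℝ => polyDerivLinear f (s • z) P)
      (polyDerivLinear f (t • z) (linForm z * P)) t := by
  have h1 := ((contDiff_polyDerivLinear hf P).differentiable (by simp) (t • z)).hasFDerivAt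
  have h2 : HasDerivAt (fun s : ℝ => s • z) z t := by
    simpa using (hasDerivAt_id t).smul_const z
  have h3 : fderiv ℝ (fun y => polyDerivLinear f y P) (t • z) z =
      polyDerivLinear f (t • z) (linForm z * P) := by
    rw [linForm, Finset.sum_mul, map_sum]
    conv_lhs => enter [2]; rw [eq_sum_smul_single z]
    rw [map_sum]
    refine Finset.sum_congr rfl fun k _ => ?_
    rw [smul_mul_assoc, map_smul, map_smul, ← partialDeriv_polyDerivLinear hf]
    rfl
  rw [← h3]
  exact h1.comp_hasDerivAt t h2

end Operators

/-! ### Taylor expansion along rays -/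

section Taylor

variable {F : Type*} [NormedAddCommGroup F] [NormedSpace ℝ F]

theorem isBigO_pow_succ_of_hasDerivAt {r r' : ℝ → F} {n : ℕ} (h : ∀ t, HasDerivAt r (r' t) t)
    (h0 : r 0 = 0) (hr' : r' =O[𝓝 0] fun t : ℝ => t ^ n) :
    r =O[𝓝 0] fun t : ℝ => t ^ (n + 1) := by
  obtain ⟨C, hC0, hC⟩ := hr'.exists_nonneg
  obtain ⟨ε, hε, hball⟩ := Metric.eventually_nhds_iff_ball.mp hC.bound
  refine IsBigO.of_bound C (Metric.eventually_nhds_iff_ball.mpr ⟨ε, hε, fun t ht => ?_⟩)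
  have hsub : ∀ s ∈ Metric.closedBall (0 : ℝ) |t|, ‖r' s‖ ≤ C * |t| ^ n := by
    intro s hs
    rw [mem_closedBall_zero_iff, Real.norm_eq_abs] at hs
    rw [mem_ball_zero_iff, Real.norm_eq_abs] at ht
    have h1 := hball s (by rw [mem_ball_zero_iff, Real.norm_eq_abs]; exact hs.trans_lt ht)
    rw [norm_pow, Real.norm_eq_abs] at h1
    exact h1.trans (by gcongr)
  have := (convex_closedBall (0 : ℝ) |t|).norm_image_sub_le_of_norm_hasDerivWithin_le
    (fun s _ => (h s).hasDerivWithinAt) hsub (x := 0) (y := t) (by simp) (by simp)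
  rw [h0, sub_zero, sub_zero] at this
  rwa [norm_pow, Real.norm_eq_abs, pow_succ, ← mul_assoc]

/-- Taylor's theorem for a vector-valued function given together with all its successive
derivatives `f 0, f 1, …`. -/
theorem taylor_isBigO_of_hasDerivAt (n : ℕ) (f : ℕ → ℝ → F)
    (h : ∀ m t, HasDerivAt (f m) (f (m + 1) t) t) :
    (fun t : ℝ => f 0 t - ∑ m ∈ Finset.range n, (t ^ m / (m.factorial : ℝ)) • f m 0) =O[𝓝 0]
      fun t : ℝ => t ^ n := by
  induction n generalizing f with
  | zero =>
    simp only [Finset.range_zero, Finset.sum_empty, sub_zero, pow_zero]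
    exact (h 0 0).continuousAt.isBigO_one ℝ
  | succ n ih =>
    have hr : ∀ t, HasDerivAt
        (fun t : ℝ => f 0 t - ∑ m ∈ Finset.range (n + 1), (t ^ m / (m.factorial : ℝ)) • f m 0)
        (f 1 t - ∑ m ∈ Finset.range n, (t ^ m / (m.factorial : ℝ)) • f (m + 1) 0) t := by
      intro t
      simp_rw [Finset.sum_range_succ' _ n, pow_zero]
      refine (h 0 t).fun_sub (HasDerivAt.add_const _ ?_)
      refine HasDerivAt.fun_sum fun m _ => ?_
      refine HasDerivAt.smul_const ?_ _
      have := (hasDerivAt_pow (m + 1) t).div_const ((m + 1).factorial : ℝ)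
      convert this using 1
      rw [Nat.factorial_succ]
      have : (m.factorial : ℝ) ≠ 0 := by positivity
      push_cast
      field_simp
    refine isBigO_pow_succ_of_hasDerivAt hr ?_ (ih (fun m => f (m + 1)) fun m => h _)
    simp [Finset.sum_range_succ' _ n]

end Taylor

/-! ### Homogeneous parts of exponential series -/

section HomPart

variable {d : ℕ}

/-- The homogeneous part of total degree `m` of a power series, as a polynomial. -/
noncomputable def homPart (m : ℕ) :
    MvPowerSeries (Fin d) ℝ →ₗ[ℝ] MvPolynomial (Fin d) ℝ where
  toFun g := ∑ α ∈ Finset.finsuppAntidiag Finset.univ m,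
    MvPolynomial.monomial α (MvPowerSeries.coeff α g)
  map_add' g h := by simp [Finset.sum_add_distrib]
  map_smul' c g := by simp [Finset.smul_sum, MvPolynomial.smul_monomial]

theorem coeff_homPart (m : ℕ) (g : MvPowerSeries (Fin d) ℝ) (β : Fin d →₀ ℕ) :
    MvPolynomial.coeff β (homPart m g) =
      if β.degree = m then MvPowerSeries.coeff β g else 0 := by
  classical
  simp only [homPart, LinearMap.coe_mk, AddHom.coe_mk, MvPolynomial.coeff_sum,
    MvPolynomial.coeff_monomial]
  rw [Finset.sum_ite_eq']
  simp [Finset.mem_finsuppAntidiag, Finsupp.degree_eq_sum]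

theorem leastTerm_eq_homPart (g : MvPowerSeries (Fin d) ℝ) :
    leastTerm g = homPart g.order.toNat g := rfl

theorem homPart_eq_zero_of_lt_order {m : ℕ} {g : MvPowerSeries (Fin d) ℝ}
    (h : m < g.order.toNat) : homPart m g = 0 := by
  ext β
  rw [coeff_homPart, MvPolynomial.coeff_zero]
  split_ifs with hβ
  · refine MvPowerSeries.coeff_of_lt_order ?_
    rw [hβ]
    exact lt_of_lt_of_le (by exact_mod_cast h) (ENat.natCast_toNat_le_self _)
  · rfl

theorem coeff_expSeries (F : MvPolynomial (Fin d) ℝ →ₗ[ℝ] ℝ) (α : Fin d →₀ ℕ) :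
    MvPowerSeries.coeff α (expSeries F) =
      F (MvPolynomial.monomial α 1) / ∏ k, ((α k).factorial : ℝ) := rfl

/-- For the evaluation at `z` the exponential series is `exp ⟨z, x⟩`, whose homogeneous parts are
the divided powers of the linear form `⟨z, X⟩`. -/
theorem homPart_expSeries_aeval (z : EuclideanSpace ℝ (Fin d)) (m : ℕ) :
    homPart m (expSeries (MvPolynomial.aeval fun j => z j).toLinearMap) =
      (m.factorial : ℝ)⁻¹ • linForm z ^ m := by
  ext β
  rw [coeff_homPart, MvPolynomial.coeff_smul, linForm,
    MvPolynomial.coeff_linearCombination_X_pow_of_fintype, coeff_expSeries]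
  have hdeg : (β.sum fun _ m => m) = β.degree := rfl
  rw [hdeg]
  split_ifs with hβ
  · have hm : (∏ k, ((β k).factorial : ℝ)) * (β.multinomial : ℝ) = m.factorial := by
      rw [← Finsupp.multinomial_of_support_subset (Finset.subset_univ _), ← hβ,
        Finsupp.degree_eq_sum]
      exact_mod_cast Nat.multinomial_spec Finset.univ β
    have h0 : (∏ k, ((β k).factorial : ℝ)) ≠ 0 := by positivity
    have h1 : (m.factorial : ℝ) ≠ 0 := by positivity
    simp only [AlgHom.toLinearMap_apply, MvPolynomial.aeval_monomial, map_one, one_mul,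
      smul_eq_mul]
    rw [← hm] at h1 ⊢
    have h2 := right_ne_zero_of_mul h1
    field_simp
  · simp

theorem homPart_zero_expSeries_comp_pderiv (F : MvPolynomial (Fin d) ℝ →ₗ[ℝ] ℝ) (k : Fin d) :
    homPart 0 (expSeries (F ∘ₗ (MvPolynomial.pderiv k).toLinearMap)) = 0 := by
  ext β
  rw [coeff_homPart, MvPolynomial.coeff_zero]
  split_ifs with hβ
  · rw [(Finsupp.degree_eq_zero_iff β).mp hβ, coeff_expSeries]
    simp
  · rfl

/-- Precomposing a functional with `∂_k` multiplies its exponential series by `x_k`. -/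
theorem homPart_succ_expSeries_comp_pderiv (F : MvPolynomial (Fin d) ℝ →ₗ[ℝ] ℝ) (k : Fin d)
    (m : ℕ) :
    homPart (m + 1) (expSeries (F ∘ₗ (MvPolynomial.pderiv k).toLinearMap)) =
      MvPolynomial.X k * homPart m (expSeries F) := by
  classical
  ext β
  rw [coeff_homPart, MvPolynomial.coeff_X_mul', coeff_homPart, coeff_expSeries, coeff_expSeries]
  have hF : ∀ P, (F ∘ₗ (MvPolynomial.pderiv k).toLinearMap) P = F (MvPolynomial.pderiv k P) :=
    fun _ => rfl
  simp only [hF, MvPolynomial.pderiv_monomial, one_mul]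
  by_cases hk : k ∈ β.support
  · have hk' : β k ≠ 0 := Finsupp.mem_support_iff.mp hk
    rw [if_pos hk]
    obtain ⟨γ, rfl⟩ : ∃ γ, β = γ + Finsupp.single k 1 :=
      ⟨β - Finsupp.single k 1, (tsub_add_cancel_of_le (by
        rw [Finsupp.single_le_iff]; omega)).symm⟩
    rw [add_tsub_cancel_right, map_add, Finsupp.degree_single]
    simp only [Nat.add_right_cancel_iff]
    split_ifs with hγ
    · have hprod : (∏ j, (((γ + Finsupp.single k 1 : Fin d →₀ ℕ) j).factorial : ℝ)) =
          (γ k + 1) * ∏ j, ((γ j).factorial : ℝ) := by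
        rw [← Finset.mul_prod_erase _ _ (Finset.mem_univ k),
          ← Finset.mul_prod_erase _ (fun j => ((γ j).factorial : ℝ)) (Finset.mem_univ k),
          ← mul_assoc]
        congr 1
        · simp [Nat.factorial_succ]
        · refine Finset.prod_congr rfl fun j hj => ?_
          simp [(Finset.ne_of_mem_erase hj).symm]
      have hmon : MvPolynomial.monomial γ (((γ + Finsupp.single k 1 : Fin d →₀ ℕ) k : ℕ) : ℝ) =
          ((γ k : ℝ) + 1) • MvPolynomial.monomial γ (1 : ℝ) := by
        rw [MvPolynomial.smul_monomial]
        simp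
      have h1 : (γ k : ℝ) + 1 ≠ 0 := by positivity
      have h0 : (∏ k, ((γ k).factorial : ℝ)) ≠ 0 := by positivity
      rw [hprod, hmon, map_smul, smul_eq_mul]
      field_simp
    · rfl
  · have hk' : β k = 0 := Finsupp.notMem_support_iff.mp hk
    simp [hk, hk']

theorem one_mem_hermiteLeastSpace {N : ℕ} (hN : 0 < N) (Z : Fin N → EuclideanSpace ℝ (Fin d)) :
    (1 : MvPolynomial (Fin d) ℝ) ∈ hermiteLeastSpace Z := by
  have hg : expSeries (hermiteFunctional Z (⟨0, hN⟩, none)) ∈ expSpace (hermiteFunctional Z) :=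
    Submodule.subset_span ⟨_, rfl⟩
  refine Submodule.subset_span ⟨_, hg, ?_⟩
  have hc : MvPowerSeries.coeff 0 (expSeries (hermiteFunctional Z (⟨0, hN⟩, none))) = 1 := by
    rw [coeff_expSeries]
    simp [hermiteFunctional]
  have ho : (expSeries (hermiteFunctional Z (⟨0, hN⟩, none))).order = 0 := by
    have := MvPowerSeries.order_le (d := 0) (f := expSeries (hermiteFunctional Z (⟨0, hN⟩, none)))
      (by rw [hc]; exact one_ne_zero)
    simpa using this
  rw [leastTerm_eq_homPart, ho]
  change homPart 0 (expSeries (MvPolynomial.aeval fun j => Z ⟨0, hN⟩ j).toLinearMap) = 1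
  rw [homPart_expSeries_aeval]
  simp

end HomPart

/-! ### Expansion of the scaled functionals -/

section Expansion

variable {d N : ℕ} {F : Type*} [NormedAddCommGroup F] [NormedSpace ℝ F]

/-- The Hermite functionals of `Z` applied to the dilated function `x ↦ φ (t x)`: the values
`φ(t z_i)` and the derivatives `t ∂_k φ(t z_i)`. -/
noncomputable def dilatedHermite (φ : EuclideanSpace ℝ (Fin d) → F)
    (Z : Fin N → EuclideanSpace ℝ (Fin d))
    (t : ℝ) : Fin N × Option (Fin d) → F
  | (i, none) => φ (t • Z i)
  | (i, some k) => t • partialDeriv k φ (t • Z i)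

/-- Taylor expansion at the origin: the dilated Hermite functional has the homogeneous parts of its
exponential series as the symbols of its Taylor coefficients. -/
theorem dilatedHermite_sub_isBigO {φ : EuclideanSpace ℝ (Fin d) → F} (hφ : ContDiff ℝ ∞ φ)
    (Z : Fin N → EuclideanSpace ℝ (Fin d)) (a : Fin N × Option (Fin d)) (n : ℕ) :
    (fun t : ℝ => dilatedHermite φ Z t a - ∑ m ∈ Finset.range (n + 1), t ^ m •
      polyDerivLinear φ 0 (homPart m (expSeries (hermiteFunctional Z a)))) =O[𝓝 0]
      fun t : ℝ => t ^ (n + 1) := by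
  have key : ∀ (P : MvPolynomial (Fin d) ℝ) (z : EuclideanSpace ℝ (Fin d)) (n : ℕ),
      (fun t : ℝ => polyDerivLinear φ (t • z) P - ∑ m ∈ Finset.range n,
        t ^ m • polyDerivLinear φ 0 (P * (m.factorial : ℝ)⁻¹ • linForm z ^ m)) =O[𝓝 0]
        fun t : ℝ => t ^ n := by
    intro P z n
    have := taylor_isBigO_of_hasDerivAt n
      (fun m t => polyDerivLinear φ (t • z) (linForm z ^ m * P)) (fun m t => by
        rw [pow_succ', mul_assoc]
        exact hasDerivAt_polyDerivLinear_smul hφ _ z t)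
    refine this.congr_left fun t => ?_
    simp only [pow_zero, one_mul, zero_smul]
    congr 1
    refine Finset.sum_congr rfl fun m _ => ?_
    rw [mul_smul_comm, map_smul, smul_smul, mul_comm P, div_eq_mul_inv]
  obtain ⟨i, _ | k⟩ := a
  · refine (key 1 (Z i) (n + 1)).congr_left fun t => ?_
    simp only [dilatedHermite, hermiteFunctional, homPart_expSeries_aeval, polyDerivLinear_one,
      one_mul]
  · have h := (isBigO_refl (fun t : ℝ => t) (𝓝 0)).smul (key (MvPolynomial.X k) (Z i) n)
    refine (h.congr_left fun t => ?_).congr_right fun t => ?_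
    · simp only [dilatedHermite, hermiteFunctional]
      rw [Finset.sum_range_succ', homPart_zero_expSeries_comp_pderiv]
      simp only [homPart_succ_expSeries_comp_pderiv, homPart_expSeries_aeval, map_zero, smul_zero,
        add_zero, smul_sub, Finset.smul_sum, smul_smul]
      congr 1
      · rw [← mul_one (MvPolynomial.X k), ← partialDeriv_polyDerivLinear hφ]
        simp only [polyDerivLinear_one]
      · refine Finset.sum_congr rfl fun m _ => ?_
        rw [pow_succ']
    · rw [smul_eq_mul, pow_succ']

/-- The leading behaviour of a combination of dilated Hermite functionals is governed by the least
term of its exponential series. -/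
theorem sum_dilatedHermite_sub_leastTerm_isBigO {φ : EuclideanSpace ℝ (Fin d) → F}
    (hφ : ContDiff ℝ ∞ φ) (Z : Fin N → EuclideanSpace ℝ (Fin d))
    (c : Fin N × Option (Fin d) → ℝ) {g : MvPowerSeries (Fin d) ℝ}
    (hg : ∑ a, c a • expSeries (hermiteFunctional Z a) = g) :
    (fun t : ℝ => (t ^ g.order.toNat)⁻¹ • ∑ a, c a • dilatedHermite φ Z t a -
      polyDerivLinear φ 0 (leastTerm g)) =O[𝓝[>] 0] fun t : ℝ => t := by
  set n := g.order.toNat with hn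
  have h1 : (fun t : ℝ => ∑ a, c a • (dilatedHermite φ Z t a - ∑ m ∈ Finset.range (n + 1), t ^ m •
      polyDerivLinear φ 0 (homPart m (expSeries (hermiteFunctional Z a))))) =O[𝓝 0]
      fun t : ℝ => t ^ (n + 1) :=
    IsBigO.fun_sum fun a _ => (dilatedHermite_sub_isBigO hφ Z a n).const_smul_left (c a)
  have h2 : ∀ t : ℝ, ∑ a, c a • (dilatedHermite φ Z t a - ∑ m ∈ Finset.range (n + 1), t ^ m •
      polyDerivLinear φ 0 (homPart m (expSeries (hermiteFunctional Z a)))) =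
      ∑ a, c a • dilatedHermite φ Z t a - t ^ n • polyDerivLinear φ 0 (leastTerm g) := by
    intro t
    simp only [smul_sub, Finset.sum_sub_distrib]
    congr 1
    have h3 : ∀ m, ∑ a, c a • t ^ m •
        polyDerivLinear φ 0 (homPart m (expSeries (hermiteFunctional Z a))) =
        t ^ m • polyDerivLinear φ 0 (homPart m g) := by
      intro m
      rw [← hg]
      simp only [map_sum, map_smul, Finset.smul_sum]
      exact Finset.sum_congr rfl fun a _ => smul_comm _ _ _
    simp only [Finset.smul_sum]
    rw [Finset.sum_comm]
    simp only [h3]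
    rw [Finset.sum_range_succ, Finset.sum_eq_zero, zero_add, leastTerm_eq_homPart]
    intro m hm
    rw [homPart_eq_zero_of_lt_order (Finset.mem_range.mp hm), map_zero, smul_zero]
  have h4 := (isBigO_refl (fun t : ℝ => (t ^ n)⁻¹) (𝓝[>] 0)).smul
    ((h1.congr_left h2).mono nhdsWithin_le_nhds)
  refine h4.congr' ?_ ?_
  · filter_upwards [self_mem_nhdsWithin] with t ht
    have ht' : t ^ n ≠ 0 := pow_ne_zero _ (ne_of_gt ht)
    rw [smul_sub, smul_smul, inv_mul_cancel₀ ht', one_smul]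
  · filter_upwards [self_mem_nhdsWithin] with t ht
    have ht' : t ^ n ≠ 0 := pow_ne_zero _ (ne_of_gt ht)
    rw [smul_eq_mul, pow_succ, ← mul_assoc, inv_mul_cancel₀ ht', one_mul]

end Expansion

/-! ### Minimal-norm solutions of finitely many linear equations -/

section MinNorm

theorem IsMinNorm.minNorm_eq {H : Type*} [NormedAddCommGroup H] {S : Set H} {p : H}
    (hp : IsMinNorm S p) : minNorm S = p := by
  have h : IsMinNorm S (minNorm S) := Classical.epsilon_spec (p := fun p => IsMinNorm S p) ⟨p, hp⟩
  by_contra hne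
  exact lt_asymm (h.2 p hp.1 (Ne.symm hne)) (hp.2 _ h.1 hne)

theorem differentiable_gram_apply {ι : Type*} [Fintype ι] {H : Type*} [NormedAddCommGroup H]
    [InnerProductSpace ℝ H] (i j : ι) :
    Differentiable ℝ fun v : ι → H => Matrix.gram ℝ v i j := by
  simp only [Matrix.gram_apply]
  exact (differentiable_apply i).inner ℝ (differentiable_apply j)

theorem differentiable_det {ι : Type*} [Fintype ι] [DecidableEq ι] {E : Type*}
    [NormedAddCommGroup E] [NormedSpace ℝ E]
    {A : E → Matrix ι ι ℝ} (hA : ∀ i j, Differentiable ℝ fun v => A v i j) :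
    Differentiable ℝ fun v => (A v).det := by
  simp only [Matrix.det_apply]
  refine Differentiable.fun_sum fun σ _ => Differentiable.const_smul ?_ _
  exact fun x => (HasFDerivAt.finsetProd fun i _ => (hA (σ i) i x).hasFDerivAt).differentiableAt

theorem gram_sum_smul {ι : Type*} [Fintype ι] {H : Type*} [NormedAddCommGroup H]
    [InnerProductSpace ℝ H] (B : Matrix ι ι ℝ) (w : ι → H) :
    Matrix.gram ℝ (fun j => ∑ a, B j a • w a) = B * Matrix.gram ℝ w * B.transpose := by
  ext i j
  simp only [Matrix.gram_apply, Matrix.mul_apply, Matrix.transpose_apply, sum_inner, inner_sum,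
    real_inner_smul_left, real_inner_smul_right, Finset.sum_mul]
  refine Finset.sum_congr rfl fun a _ => Finset.sum_congr rfl fun b _ => ?_
  ring

variable {ι : Type*} [Fintype ι] [DecidableEq ι] {H : Type*} [NormedAddCommGroup H]
  [InnerProductSpace ℝ H]

/-- The solution of the equations `⟪v j, p⟫ = b j` in the span of the `v j`, by Cramer's rule for
the Gram matrix (meaningful only when the Gram determinant does not vanish). -/
noncomputable def gramSolution (v : ι → H) (b : ι → ℝ) : H :=
  ∑ i, ((Matrix.gram ℝ v).det⁻¹ * (Matrix.gram ℝ v).cramer b i) • v i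

theorem inner_gramSolution {v : ι → H} (hv : (Matrix.gram ℝ v).det ≠ 0) (b : ι → ℝ) (j : ι) :
    inner ℝ (v j) (gramSolution v b) = b j := by
  have h := congrFun (Matrix.mulVec_cramer (Matrix.gram ℝ v) b) j
  simp only [Matrix.mulVec, dotProduct, Matrix.gram_apply, Pi.smul_apply, smul_eq_mul] at h
  simp only [gramSolution, inner_sum, real_inner_smul_right]
  calc ∑ i, (Matrix.gram ℝ v).det⁻¹ * (Matrix.gram ℝ v).cramer b i * inner ℝ (v j) (v i)
      = (Matrix.gram ℝ v).det⁻¹ *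
          ∑ i, inner ℝ (v j) (v i) * (Matrix.gram ℝ v).cramer b i := by
        rw [Finset.mul_sum]
        exact Finset.sum_congr rfl fun i _ => by ring
    _ = b j := by rw [h, inv_mul_cancel_left₀ hv]

/-- Two solutions differ by a vector orthogonal to all `v j`, hence to `gramSolution v b`. -/
theorem isMinNorm_gramSolution {v : ι → H} (hv : (Matrix.gram ℝ v).det ≠ 0) (b : ι → ℝ) :
    IsMinNorm {p | ∀ j, inner ℝ (v j) p = b j} (gramSolution v b) := by
  refine ⟨inner_gramSolution hv b, fun q hq hne => ?_⟩
  set p := gramSolution v b with hp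
  have horth : inner ℝ p (q - p) = 0 := by
    have : ∀ j, inner ℝ (v j) (q - p) = 0 := fun j => by
      rw [inner_sub_right, hq j, inner_gramSolution hv b j, sub_self]
    generalize q - p = u at this
    rw [hp, gramSolution, sum_inner]
    exact Finset.sum_eq_zero fun j _ => by rw [real_inner_smul_left, this, mul_zero]
  have h := norm_add_sq_eq_norm_sq_add_norm_sq_of_inner_eq_zero p (q - p) horth
  rw [add_sub_cancel] at h
  have h0 : 0 < ‖q - p‖ := norm_pos_iff.mpr (sub_ne_zero.mpr hne)
  have := norm_nonneg q
  nlinarith [norm_nonneg p]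

theorem differentiable_gram_det :
    Differentiable ℝ fun v : ι → H => (Matrix.gram ℝ v).det :=
  differentiable_det differentiable_gram_apply

theorem differentiableAt_gramSolution {v : ι → H} (hv : (Matrix.gram ℝ v).det ≠ 0) (b : ι → ℝ) :
    DifferentiableAt ℝ (fun v : ι → H => gramSolution v b) v := by
  refine DifferentiableAt.fun_sum fun i _ => DifferentiableAt.smul (DifferentiableAt.mul ?_ ?_) ?_
  · exact (differentiable_gram_det v).inv hv
  · simp only [Matrix.cramer_apply]
    refine (differentiable_det fun k l => ?_) v
    simp only [Matrix.updateCol_apply]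
    split_ifs
    · exact differentiable_const _
    · exact differentiable_gram_apply k l
  · exact differentiable_apply i v

/-- If the transformed system has a nonzero Gram determinant, the transformation is invertible, so
that the two systems of equations have the same solutions. -/
theorem setOf_inner_eq_of_gram_det_ne_zero (B : Matrix ι ι ℝ) (w : ι → H) (e : ι → ℝ)
    (hB : (Matrix.gram ℝ fun j => ∑ a, B j a • w a).det ≠ 0) :
    {p : H | ∀ a, inner ℝ (w a) p = e a} =
      {p | ∀ j, inner ℝ (∑ a, B j a • w a) p = ∑ a, B j a * e a} := by
  have hdet : B.det ≠ 0 := by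
    intro h
    rw [gram_sum_smul, Matrix.det_mul, Matrix.det_mul, h] at hB
    simp at hB
  have hinj : Function.Injective B.mulVec :=
    Matrix.mulVec_injective_iff_isUnit.mpr ((Matrix.isUnit_iff_isUnit_det B).mpr hdet.isUnit)
  have hsum : ∀ (p : H) j, inner ℝ (∑ a, B j a • w a) p = ∑ a, B j a * inner ℝ (w a) p := by
    intro p j
    simp only [sum_inner, real_inner_smul_left]
  refine Set.ext fun p => ⟨fun h j => ?_, fun h a => ?_⟩
  · rw [hsum]
    exact Finset.sum_congr rfl fun a _ => by rw [h a]
  · exact congrFun (hinj (a₁ := fun a => inner ℝ (w a) p) (a₂ := e)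
      (funext fun j => (hsum p j).symm.trans (h j))) a

theorem gram_det_ne_zero_of_linearIndependent {v : ι → H} (hv : LinearIndependent ℝ v) :
    (Matrix.gram ℝ v).det ≠ 0 :=
  (Matrix.posDef_gram_of_linearIndependent hv).det_pos.ne'

end MinNorm

/-! ### The constraints of the pre-certificates as inner-product equations -/

section Constraints

variable {d N : ℕ} {H : Type*} [NormedAddCommGroup H] [InnerProductSpace ℝ H]
  {φ : EuclideanSpace ℝ (Fin d) → H}

theorem adjointMap_eq_innerSL (φ : EuclideanSpace ℝ (Fin d) → H) (p : H) :
    adjointMap φ p = fun x => innerSL ℝ p (φ x) := by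
  funext x
  exact real_inner_comm _ _

theorem polyDeriv_adjointMap (hφ : ContDiff ℝ ∞ φ) (p : H) (P : MvPolynomial (Fin d) ℝ)
    (x : EuclideanSpace ℝ (Fin d)) :
    polyDeriv P (adjointMap φ p) x = inner ℝ (polyDerivLinear φ x P) p := by
  rw [adjointMap_eq_innerSL, polyDerivLinear_apply, real_inner_comm]
  simp only [polyDeriv, inner_sum, real_inner_smul_right]
  refine Finset.sum_congr rfl fun α _ => ?_
  rw [multiDeriv_clm_comp (innerSL ℝ p) α hφ]
  rfl

theorem partialDeriv_adjointMap (hφ : ContDiff ℝ ∞ φ) (p : H) (k : Fin d)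
    (x : EuclideanSpace ℝ (Fin d)) :
    partialDeriv k (adjointMap φ p) x = inner ℝ (partialDeriv k φ x) p := by
  rw [adjointMap_eq_innerSL, partialDeriv_clm_comp (innerSL ℝ p) k hφ, real_inner_comm]
  rfl

/-- Since the constants belong to `S_Z`, the constraints of `feasibleW` amount to
`(P(∂)[Φ^* p])(0) = P(0)` for all `P ∈ S_Z`. -/
theorem mem_feasibleW_iff (hN : 0 < N) (hφ : ContDiff ℝ ∞ φ)
    (Z : Fin N → EuclideanSpace ℝ (Fin d)) (p : H) :
    p ∈ feasibleW φ Z ↔ ∀ P ∈ hermiteLeastSpace Z,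
      inner ℝ (polyDerivLinear φ 0 P) p = MvPolynomial.eval 0 P := by
  have h1 := one_mem_hermiteLeastSpace hN Z
  constructor
  · rintro ⟨h0, h⟩ P hP
    have hmem : P - MvPolynomial.eval 0 P • (1 : MvPolynomial (Fin d) ℝ) ∈ hermiteLeastSpace Z :=
      Submodule.sub_mem _ hP (Submodule.smul_mem _ _ h1)
    have := h _ hmem (by simp)
    rw [polyDeriv_adjointMap hφ, map_sub, map_smul, polyDerivLinear_one, inner_sub_left,
      real_inner_smul_left] at this
    change inner ℝ (φ 0) p = 1 at h0
    rw [h0] at this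
    linarith
  · intro h
    refine ⟨?_, fun P hP hP0 => ?_⟩
    · have := h 1 h1
      rwa [polyDerivLinear_one, map_one] at this
    · rw [polyDeriv_adjointMap hφ, h P hP, hP0]

theorem gradient_eq_zero_iff_partialDeriv (f : EuclideanSpace ℝ (Fin d) → ℝ)
    (x : EuclideanSpace ℝ (Fin d)) : gradient f x = 0 ↔ ∀ k, partialDeriv k f x = 0 := by
  rw [gradient, LinearIsometryEquiv.map_eq_zero_iff]
  constructor
  · intro h k
    rw [partialDeriv, h, zero_apply]
  · intro h
    ext z
    rw [eq_sum_smul_single z, map_sum, zero_apply]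
    refine Finset.sum_eq_zero fun k _ => ?_
    rw [map_smul]
    exact (congrArg _ (h k)).trans (smul_zero _)

/-- For `t ≠ 0` the constraints at `t Z` say that `Φ^* p`, dilated by `t`, has the same Hermite data
at `Z` as the constant `1`. -/
theorem feasibleV_smul (hφ : ContDiff ℝ ∞ φ) (Z : Fin N → EuclideanSpace ℝ (Fin d)) {t : ℝ}
    (ht : t ≠ 0) :
    feasibleV φ (t • Z) =
      {p | ∀ a, inner ℝ (dilatedHermite φ Z t a) p = hermiteFunctional Z a 1} := by
  refine Set.ext fun p => ⟨fun h => ?_, fun h i => ?_⟩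
  · rintro ⟨i, _ | k⟩
    · simpa [hermiteFunctional, dilatedHermite, adjointMap] using (h i).1
    · have h2 := (gradient_eq_zero_iff_partialDeriv _ _).mp (h i).2 k
      rw [partialDeriv_adjointMap hφ, Pi.smul_apply] at h2
      simp [hermiteFunctional, dilatedHermite, real_inner_smul_left, h2]
  · refine ⟨?_, (gradient_eq_zero_iff_partialDeriv _ _).mpr fun k => ?_⟩
    · simpa [hermiteFunctional, dilatedHermite, adjointMap] using h (i, none)
    · have h2 := h (i, some k)
      simp only [dilatedHermite, real_inner_smul_left, hermiteFunctional] at h2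
      rw [partialDeriv_adjointMap hφ, Pi.smul_apply]
      simpa [ht] using h2

/-- The right-hand sides of the rescaled constraints do not depend on `t`: a combination of the
functionals of positive order annihilates constants. -/
theorem inv_pow_order_mul_sum_hermiteFunctional_one (Z : Fin N → EuclideanSpace ℝ (Fin d))
    (c : Fin N × Option (Fin d) → ℝ) {g : MvPowerSeries (Fin d) ℝ}
    (hg : ∑ a, c a • expSeries (hermiteFunctional Z a) = g) (t : ℝ) :
    (t ^ g.order.toNat)⁻¹ * ∑ a, c a * hermiteFunctional Z a 1 =
      MvPolynomial.eval 0 (leastTerm g) := by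
  have h0 : ∑ a, c a * hermiteFunctional Z a 1 = MvPowerSeries.coeff 0 g := by
    rw [← hg]
    simp only [map_sum, map_smul, coeff_expSeries, smul_eq_mul]
    refine Finset.sum_congr rfl fun a _ => ?_
    simp
  have h1 : MvPolynomial.eval 0 (leastTerm g) =
      if 0 = g.order.toNat then MvPowerSeries.coeff 0 g else 0 := by
    rw [leastTerm_eq_homPart, MvPolynomial.eval_zero, MvPolynomial.constantCoeff_eq, coeff_homPart,
      map_zero]
  rw [h0, h1]
  split_ifs with h
  · rw [← h, pow_zero, inv_one, one_mul]
  · rw [MvPowerSeries.coeff_of_lt_order, mul_zero]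
    rw [map_zero]
    exact lt_of_lt_of_le (by exact_mod_cast Nat.pos_of_ne_zero (Ne.symm h))
      (ENat.natCast_toNat_le_self _)

end Constraints

/-! ### Adapted combinations of the Hermite functionals -/

section Adapted

variable {d N : ℕ} {H : Type*} [NormedAddCommGroup H] [InnerProductSpace ℝ H]
  {φ : EuclideanSpace ℝ (Fin d) → H}

/-- The vectors `g_↓(∂)φ(0)` with `g` in the exponential space span a space of dimension
`(d + 1) N`, so a linearly independent family of that size can be chosen among them; `c` holds the
coefficients of the corresponding `g`. -/
theorem exists_linearIndependent_leastTerm (hN : 0 < N) (Z : Fin N → EuclideanSpace ℝ (Fin d))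
    (hdim : Set.finrank ℝ
      {v : H | ∃ h ∈ hermiteLeastSpace Z, v = polyDeriv h φ 0} = (d + 1) * N) :
    ∃ c : Fin N × Option (Fin d) → Fin N × Option (Fin d) → ℝ,
      LinearIndependent ℝ fun j => polyDerivLinear φ 0
        (leastTerm (∑ a, c j a • expSeries (hermiteFunctional Z a))) := by
  set s : Set H := (fun g => polyDerivLinear φ 0 (leastTerm g)) ''
    (expSpace (hermiteFunctional Z) : Set (MvPowerSeries (Fin d) ℝ)) with hs
  have hspan : Submodule.span ℝ s =
      Submodule.span ℝ {v : H | ∃ h ∈ hermiteLeastSpace Z, v = polyDeriv h φ 0} := by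
    have h1 : {v : H | ∃ h ∈ hermiteLeastSpace Z, v = polyDeriv h φ 0} =
        ((hermiteLeastSpace Z).map (polyDerivLinear φ 0) : Submodule ℝ H) := by
      refine Set.ext fun v => ⟨?_, ?_⟩
      · rintro ⟨h, hh, rfl⟩
        exact ⟨h, hh, rfl⟩
      · rintro ⟨h, hh, rfl⟩
        exact ⟨h, hh, rfl⟩
    rw [h1, Submodule.span_eq, hermiteLeastSpace, leastInterpolant, Submodule.map_span,
      Set.image_image]
  rw [Set.finrank, ← hspan] at hdim
  have hfinite : Module.Finite ℝ (Submodule.span ℝ s) :=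
    Module.finite_of_finrank_pos (by rw [hdim]; positivity)
  obtain ⟨f, hfs, -, hf⟩ := Submodule.exists_fun_fin_finrank_span_eq ℝ s
  have hcard : Fintype.card (Fin N × Option (Fin d)) =
      Module.finrank ℝ (Submodule.span ℝ s) := by
    rw [hdim]
    simp [mul_comm]
  let e := Fintype.equivFinOfCardEq hcard
  have hc : ∀ j, ∃ c : Fin N × Option (Fin d) → ℝ, polyDerivLinear φ 0
      (leastTerm (∑ a, c a • expSeries (hermiteFunctional Z a))) = f (e j) := by
    intro j
    obtain ⟨g, hg, hgf⟩ := hfs (e j)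
    obtain ⟨c, hc⟩ := (Submodule.mem_span_range_iff_exists_fun ℝ).mp hg
    exact ⟨c, by rw [hc]; exact hgf⟩
  choose c hc using hc
  refine ⟨c, ?_⟩
  simp only [hc]
  exact hf.comp e e.injective

end Adapted

end Superres

theorem mainTheorem2 {d N : ℕ} (hN : 0 < N)
    {H : Type*} [NormedAddCommGroup H] [InnerProductSpace ℝ H] [CompleteSpace H]
    (φ : EuclideanSpace ℝ (Fin d) → H) (hφ : ContDiff ℝ ∞ φ)
    (Z : Fin N → EuclideanSpace ℝ (Fin d))
    (hdim : Set.finrank ℝ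
      {v : H | ∃ h ∈ Superres.hermiteLeastSpace Z, v = Superres.polyDeriv h φ 0} = (d + 1) * N) :
    Superres.IsMinNorm (Superres.feasibleW φ Z) (Superres.pW φ Z) ∧
    (∀ᶠ t : ℝ in 𝓝[>] 0,
      Superres.IsMinNorm (Superres.feasibleV φ (t • Z)) (Superres.pV φ (t • Z))) ∧
    (fun t : ℝ => Superres.pV φ (t • Z) - Superres.pW φ Z) =O[𝓝[>] 0] (fun t : ℝ => t) ∧
    ((∃ B : ℝ, ∀ x, ‖φ x‖ ≤ B) →
      ∃ C : ℝ, ∀ᶠ t : ℝ in 𝓝[>] 0,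
        ∀ x, |Superres.etaV φ (t • Z) x - Superres.etaW φ Z x| ≤ C * t) := by
  open Superres in
  obtain ⟨c, hc⟩ := exists_linearIndependent_leastTerm hN Z hdim
  set w := dilatedHermite φ Z with hw
  -- `v t j` is the `j`-th combination divided by `t ^ n`, with `n` the order of its series `ser (c j)`,
  -- and `v₀` is the limit of `v t`
  let ser : (Fin N × Option (Fin d) → ℝ) → MvPowerSeries (Fin d) ℝ :=
    fun c => ∑ a, c a • expSeries (hermiteFunctional Z a)
  let B : ℝ → Matrix (Fin N × Option (Fin d)) (Fin N × Option (Fin d)) ℝ :=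
    fun t j a => (t ^ (ser (c j)).order.toNat)⁻¹ * c j a
  let v : ℝ → Fin N × Option (Fin d) → H := fun t j => ∑ a, B t j a • w t a
  let v₀ : Fin N × Option (Fin d) → H := fun j => polyDerivLinear φ 0 (leastTerm (ser (c j)))
  let b : Fin N × Option (Fin d) → ℝ := fun j => MvPolynomial.eval 0 (leastTerm (ser (c j)))
  have hdet₀ : (Matrix.gram ℝ v₀).det ≠ 0 := gram_det_ne_zero_of_linearIndependent hc
  have hvO : (fun t => v t - v₀) =O[𝓝[>] 0] fun t : ℝ => t := by
    refine isBigO_pi.mpr fun j => ?_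
    refine (sum_dilatedHermite_sub_leastTerm_isBigO hφ Z (c j) rfl).congr_left fun t => ?_
    simp only [v, v₀, B, ser, hw, Pi.sub_apply, Finset.smul_sum, mul_smul]
  have hid : Tendsto (fun t : ℝ => t) (𝓝[>] 0) (𝓝 0) :=
    tendsto_nhdsWithin_of_tendsto_nhds tendsto_id
  have hvT : Tendsto v (𝓝[>] 0) (𝓝 v₀) := tendsto_sub_nhds_zero_iff.mp (hvO.trans_tendsto hid)
  have hdet : ∀ᶠ t in 𝓝[>] (0 : ℝ), (Matrix.gram ℝ (v t)).det ≠ 0 :=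
    ((differentiable_gram_det.continuous.tendsto v₀).comp hvT).eventually_ne hdet₀
  -- for small `t > 0` the constraints at `t Z` are equivalent to the rescaled ones
  have hV : ∀ᶠ t in 𝓝[>] (0 : ℝ),
      IsMinNorm (feasibleV φ (t • Z)) (gramSolution (v t) b) := by
    filter_upwards [hdet, self_mem_nhdsWithin] with t ht htpos
    rw [feasibleV_smul hφ Z (ne_of_gt htpos), ← hw,
      setOf_inner_eq_of_gram_det_ne_zero (B t) (w t) _ ht]
    have hb : ∀ j, ∑ a, B t j a * hermiteFunctional Z a 1 = b j := by
      intro j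
      refine Eq.trans ?_ (inv_pow_order_mul_sum_hermiteFunctional_one Z (c j) rfl t)
      simp only [B, ser, Finset.mul_sum, mul_assoc]
    simp only [hb]
    exact isMinNorm_gramSolution ht b
  have hpO : (fun t => gramSolution (v t) b - gramSolution v₀ b) =O[𝓝[>] 0] fun t : ℝ => t :=
    ((differentiableAt_gramSolution hdet₀ b).isBigO_sub.comp_tendsto hvT).trans hvO
  have hpT : Tendsto (fun t => gramSolution (v t) b) (𝓝[>] 0) (𝓝 (gramSolution v₀ b)) :=
    tendsto_sub_nhds_zero_iff.mp (hpO.trans_tendsto hid)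
  -- every element of `expSpace` gives a rescaled constraint satisfied by the minimizers for
  -- small `t`; its limit as `t → 0` is the corresponding constraint of `feasibleW`
  have hlim : ∀ g ∈ expSpace (hermiteFunctional Z),
      inner ℝ (polyDerivLinear φ 0 (leastTerm g)) (gramSolution v₀ b) =
        MvPolynomial.eval 0 (leastTerm g) := by
    intro g hg
    obtain ⟨γ, hγ⟩ := (Submodule.mem_span_range_iff_exists_fun ℝ).mp hg
    have h1 : Tendsto (fun t : ℝ => (t ^ g.order.toNat)⁻¹ • ∑ a, γ a • w t a) (𝓝[>] 0)
        (𝓝 (polyDerivLinear φ 0 (leastTerm g))) :=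
      tendsto_sub_nhds_zero_iff.mp
        ((sum_dilatedHermite_sub_leastTerm_isBigO hφ Z γ hγ).trans_tendsto hid)
    refine tendsto_nhds_unique (h1.inner hpT) (tendsto_const_nhds.congr' ?_)
    filter_upwards [hV, self_mem_nhdsWithin] with t ht htpos
    have hmem := ht.1
    rw [feasibleV_smul hφ Z (ne_of_gt htpos)] at hmem
    rw [real_inner_smul_left, sum_inner, ← inv_pow_order_mul_sum_hermiteFunctional_one Z γ hγ t]
    congr 1
    exact Finset.sum_congr rfl fun a _ => by rw [real_inner_smul_left, hw, hmem a]
  have hW : IsMinNorm (feasibleW φ Z) (gramSolution v₀ b) := by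
    refine ⟨(mem_feasibleW_iff hN hφ Z _).mpr fun P hP => ?_, fun q hq hne => ?_⟩
    · refine Submodule.span_induction ?_ ?_ ?_ ?_ hP
      · rintro _ ⟨g, hg, rfl⟩
        exact hlim g hg
      · simp
      · intro P Q _ _ hP hQ
        rw [map_add, inner_add_left, hP, hQ, map_add]
      · intro r P _ hP
        rw [map_smul, real_inner_smul_left, hP, MvPolynomial.smul_eval]
    · refine (isMinNorm_gramSolution hdet₀ b).2 q (fun j => ?_) hne
      refine (mem_feasibleW_iff hN hφ Z q).mp hq _ (Submodule.subset_span ⟨_, ?_, rfl⟩)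
      exact (Submodule.mem_span_range_iff_exists_fun ℝ).mpr ⟨c j, rfl⟩
  have hpW : pW φ Z = gramSolution v₀ b := hW.minNorm_eq
  have hpV : ∀ᶠ t in 𝓝[>] (0 : ℝ), pV φ (t • Z) = gramSolution (v t) b :=
    hV.mono fun t ht => ht.minNorm_eq
  have hO : (fun t : ℝ => pV φ (t • Z) - pW φ Z) =O[𝓝[>] 0] (fun t : ℝ => t) := by
    refine hpO.congr' ?_ EventuallyEq.rfl
    filter_upwards [hpV] with t ht
    rw [ht, hpW]
  refine ⟨hpW ▸ hW, ?_, hO, ?_⟩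
  · filter_upwards [hV, hpV] with t ht htp
    rwa [htp]
  · rintro ⟨M, hM⟩
    obtain ⟨C, hC⟩ := hO.bound
    refine ⟨M * C, ?_⟩
    filter_upwards [hC, self_mem_nhdsWithin] with t ht htpos x
    rw [Real.norm_eq_abs, abs_of_pos htpos] at ht
    change |inner ℝ (φ x) (pV φ (t • Z)) - inner ℝ (φ x) (pW φ Z)| ≤ _
    rw [← inner_sub_right, mul_assoc]
    exact (abs_real_inner_le_norm _ _).trans
      (mul_le_mul (hM x) ht (norm_nonneg _) ((norm_nonneg _).trans (hM x)))
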